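/- Definitions. All graphs are finite and simple. A graphon on a probability space $(\Omega,\mu)$ is a symmetric measurable function $W:\Omega^2\to[0,1]$. For a graph $H$ put $t(H,W)=\mathbb{E}\bigl(\prod_{uv\in E(H)}W(x_u,x_v)\bigr)$, where the points $x_v$ ($v\in V(H)$) are chosen independently from $(\Omega,\mu)$. Let $P_2$ denote the single edge. A graph $H$ is called Sidorenko if it is bipartite and $t(H,W)\ge t(P_2,W)^{|E(H)|}$ for every graphon $W$ on every probability space. Let $G$ be a graph, $K\subseteq V(G)$, and let $S\subseteq K$ be an independent set. Reflecting $G[K]$ along $S$ means taking a disjoint copy of the induced subgraph $G[K]$, gluing it to $G$ by identifying each vertex of $S$ in the copy with the corresponding vertex of $G$, and reducing multiple edges. A reflection tree is a graph isomorphic to one obtained from a tree $T$ by reflecting a finite (possibly empty, possibly repetitive) collection of subtrees $T[K_1],\dots,T[K_r]$ of $T$ along independent sets $S_1\subseteq K_1,\dots,S_r\subseteq K_r$: for each $i$ a separate new copy of $T[K_i]$ is glued to $T$ along $S_i$. Theorem (Reflection trees are Sidorenko). Every reflection tree is a Sidorenko graph. Moreover, every even cycle $C_{2k}$ with $k\ge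 2$ is a reflection tree, and so is every Conlon–Fox–Sudakov graph, that is, every bipartite graph $H$ with a bipartition $V(H)=A\sqcup B$ and a vertex $x\in A$ that is adjacent to all vertices of $B$. -/

import Mathlib

open MeasureTheory

/-- A graphon on a space `Ω`: a measurable symmetric function `Ω × Ω → [0, 1]`. -/
structure Graphon (Ω : Type*) [MeasurableSpace Ω] where
  toFun : Ω → Ω → ℝ
  measurable_toFun : Measurable (Function.uncurry toFun)
  symm_toFun : ∀ x y, toFun x y = toFun y x
  nonneg : ∀ x y, 0 ≤ toFun x y
  le_one : ∀ x y, toFun x y ≤ 1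

/-- The value `W (φ u) (φ v)` at the unordered pair `{u, v}`, for an assignment `φ` of points
to vertices. -/
def Graphon.edgeValue {Ω V : Type*} [MeasurableSpace Ω] (W : Graphon Ω) (φ : V → Ω) :
    Sym2 V → ℝ :=
  Sym2.lift ⟨fun u v => W.toFun (φ u) (φ v), fun u v => W.symm_toFun (φ u) (φ v)⟩

open Classical in
/-- The density `t(H, W)`: the expectation of the product of `W (x_u, x_v)` over the edges `uv` of
`H`, where the points `x_v`, for `v` a vertex of `H`, are independent with law `μ`. -/
noncomputable def homDensity {Ω V : Type*} [MeasurableSpace Ω] [Fintype V]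
    (μ : Measure Ω) (H : SimpleGraph V) (W : Graphon Ω) : ℝ :=
  ∫ φ : V → Ω, ∏ e ∈ H.edgeFinset, W.edgeValue φ e ∂(Measure.pi fun _ : V => μ)

universe u v

/-- `H` is a Sidorenko graph: `H` is bipartite and `t(H, W) ≥ t(P₂, W) ^ |E(H)|` for every graphon
`W` on every probability space, where `P₂` is the single edge. -/
def IsSidorenko {V : Type u} [Fintype V] (H : SimpleGraph V) : Prop :=
  H.IsBipartite ∧
    ∀ (Ω : Type v) [MeasurableSpace Ω] (μ : Measure Ω) [IsProbabilityMeasure μ] (W : Graphon Ω),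
      homDensity μ (SimpleGraph.pathGraph 2) W ^ H.edgeSet.ncard ≤ homDensity μ H W

/-- Simultaneous reflection of the induced subgraphs `G[K i]` along the sets `S i ⊆ K i`: for every
index `i` a new copy of `G[K i]` is glued to `G` by identifying each vertex of `S i` in the copy
with the same vertex of `G` (and reducing multiple edges).  The vertex `Sum.inl x` is the vertex `x`
of `G`; the vertex `Sum.inr ⟨i, y⟩` is the new copy of the vertex `y ∈ K i \ S i`. -/
def reflectionGraph {U ι : Type*} (G : SimpleGraph U) (K S : ι → Set U) :
    SimpleGraph (U ⊕ (Σ i, ↥(K i \ S i))) where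
  Adj
    | .inl x, .inl y => G.Adj x y
    | .inl x, .inr ⟨i, y⟩ => x ∈ S i ∧ G.Adj x y
    | .inr ⟨i, x⟩, .inl y => y ∈ S i ∧ G.Adj x y
    | .inr ⟨i, x⟩, .inr ⟨j, y⟩ => i = j ∧ G.Adj x y
  symm := ⟨by
    rintro (x | ⟨i, x⟩) (y | ⟨j, y⟩) h
    · exact SimpleGraph.Adj.symm h
    · exact ⟨h.1, h.2.symm⟩
    · exact ⟨h.1, h.2.symm⟩
    · exact ⟨h.1.symm, h.2.symm⟩⟩
  loopless := ⟨by
    rintro (x | ⟨i, x⟩) h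
    · exact G.loopless.irrefl x h
    · exact G.loopless.irrefl _ h.2⟩

/-- A reflection tree is a graph isomorphic to one obtained from a finite tree `T` by reflecting a
finite collection of subtrees `T[K i]`, each along an independent set `S i ⊆ K i`. -/
def IsReflectionTree {V : Type*} (H : SimpleGraph V) : Prop :=
  ∃ (n r : ℕ) (T : SimpleGraph (Fin n)) (K S : Fin r → Set (Fin n)),
    T.IsTree ∧
    (∀ i, (T.induce (K i)).IsTree ∧ S i ⊆ K i ∧ T.IsIndepSet (S i)) ∧
    Nonempty (H ≃g reflectionGraph T K S)

/-- `H` has a bipartition (a partition of its vertex set into two independent sets `A` and `B`) and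
a vertex in `A` that is adjacent to all of `B`. -/
def HasVertexCompleteToOtherSide {V : Type*} (H : SimpleGraph V) : Prop :=
  ∃ (A B : Set V) (x : V), H.IsBipartiteWith A B ∧ A ∪ B = Set.univ ∧ x ∈ A ∧
    ∀ b ∈ B, H.Adj x b

/-! This is an entropy argument, with Jensen's inequality in place of entropies. Let `W` be bounded
below by a positive constant, with degree function `d` and edge density `p`. On a subtree `T[K]` run
the branching random walk: one vertex has density `d / p`, and each further vertex is reached from
its neighbour with transition density `W(a, b) / d(a)`. The joint density is `τ_K = ∏ W / q_K`,
where `q_K = p ∏ d(x_v) ^ (deg v - 1)`. It does not depend on the starting vertex, so every vertex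
has density `d / p`, and the marginal of `τ_T` on a subtree `K` is `τ_K`
(`integral_branching_univ_mul`).

Let `H` come from `T` by reflecting the `T[K i]` along the `S i`. Given the points `x` of `T`, the
copies are independent, so `t(H, W) = ∫ ∏_T W · ∏ R_i`, where `R_i(x)` is the density of `T[K i]`
with only the points of `K i \ S i` averaged. This equals `E_τ(q_T ∏ R_i)` with `τ = τ_T`, so by
Jensen `log t(H, W) ≥ E_τ log q_T + ∑ E_τ log R_i`.

Two bounds finish the proof. Firstly, `E log q_K ≥ e(K) log p` if `K` has an edge, because `E log d
≥ log p` at every vertex (`card_mul_log_density_le`). Secondly, `E log R_i ≥ E log q_{K i}` under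
the marginal `τ_{K i}`, because `∫ ∏ W / R_i = 1` (`integral_log_ratio_le_integral_log_rooted`). As
each `S i` is independent, no copied edge is lost by merging, and the exponents add up to `e(H)`.
General graphons are limits of positive ones. -/

/-! ### Bounded functions and Jensen's inequality -/

/-- Measurable functions bounded in absolute value. -/
structure BddMeas {X : Type*} [MeasurableSpace X] (f : X → ℝ) : Prop where
  measurable : Measurable f
  bdd : ∃ C, ∀ x, |f x| ≤ C

/-- Measurable functions with values in a compact subset of the positive reals. -/
structure BddPos {X : Type*} [MeasurableSpace X] (f : X → ℝ) : Prop where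
  measurable : Measurable f
  lower : ∃ a, 0 < a ∧ ∀ x, a ≤ f x
  upper : ∃ b, ∀ x, f x ≤ b

section Bounded

variable {X Y : Type*} [MeasurableSpace X] [MeasurableSpace Y] {f g : X → ℝ}

theorem BddMeas.integrable (hf : BddMeas f) (μ : Measure X) [IsFiniteMeasure μ] :
    Integrable f μ := by
  obtain ⟨C, hC⟩ := hf.bdd
  exact .of_bound hf.measurable.aestronglyMeasurable C (.of_forall hC)

theorem BddMeas.mul (hf : BddMeas f) (hg : BddMeas g) : BddMeas fun x => f x * g x := by
  obtain ⟨C, hC⟩ := hf.bdd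
  obtain ⟨D, hD⟩ := hg.bdd
  refine ⟨hf.measurable.mul hg.measurable, C * D, fun x => ?_⟩
  rw [abs_mul]
  exact mul_le_mul (hC x) (hD x) (abs_nonneg _) ((abs_nonneg _).trans (hC x))

theorem BddMeas.add (hf : BddMeas f) (hg : BddMeas g) : BddMeas fun x => f x + g x := by
  obtain ⟨C, hC⟩ := hf.bdd
  obtain ⟨D, hD⟩ := hg.bdd
  exact ⟨hf.measurable.add hg.measurable, C + D, fun x =>
    (abs_add_le _ _).trans (add_le_add (hC x) (hD x))⟩

theorem BddMeas.const (c : ℝ) : BddMeas fun _ : X => c :=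
  ⟨measurable_const, |c|, fun _ => le_rfl⟩

theorem BddMeas.sum {ι : Type*} {F : ι → X → ℝ} (s : Finset ι)
    (h : ∀ i ∈ s, BddMeas (F i)) : BddMeas fun x => ∑ i ∈ s, F i x := by
  classical
  induction s using Finset.induction_on with
  | empty => simpa using BddMeas.const (X := X) 0
  | insert i s hi ih =>
    simp only [Finset.sum_insert hi]
    exact (h i (by simp)).add (ih fun j hj => h j (by simp [hj]))

theorem BddMeas.prod {ι : Type*} {F : ι → X → ℝ} (s : Finset ι)
    (h : ∀ i ∈ s, BddMeas (F i)) : BddMeas fun x => ∏ i ∈ s, F i x := by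
  classical
  induction s using Finset.induction_on with
  | empty => simpa using BddMeas.const (X := X) 1
  | insert i s hi ih =>
    simp only [Finset.prod_insert hi]
    exact (h i (by simp)).mul (ih fun j hj => h j (by simp [hj]))

theorem BddMeas.comp (hf : BddMeas f) {g : Y → X} (hg : Measurable g) :
    BddMeas fun y => f (g y) :=
  ⟨hf.measurable.comp hg, hf.bdd.imp fun _ h y => h (g y)⟩

theorem BddPos.pos (hf : BddPos f) (x : X) : 0 < f x := by
  obtain ⟨a, ha, h⟩ := hf.lower
  exact ha.trans_le (h x)

theorem BddPos.bddMeas (hf : BddPos f) : BddMeas f := by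
  obtain ⟨b, h⟩ := hf.upper
  exact ⟨hf.measurable, b, fun x => by rw [abs_of_pos (hf.pos x)]; exact h x⟩

theorem BddPos.mul (hf : BddPos f) (hg : BddPos g) : BddPos fun x => f x * g x := by
  obtain ⟨a, ha, h⟩ := hf.lower
  obtain ⟨a', ha', h'⟩ := hg.lower
  obtain ⟨b, k⟩ := hf.upper
  obtain ⟨b', k'⟩ := hg.upper
  refine ⟨hf.measurable.mul hg.measurable, ⟨a * a', mul_pos ha ha', fun x => ?_⟩,
    b * b', fun x => ?_⟩
  · exact mul_le_mul (h x) (h' x) ha'.le (hf.pos x).le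
  · exact mul_le_mul (k x) (k' x) (hg.pos x).le ((hf.pos x).le.trans (k x))

theorem BddPos.const {c : ℝ} (hc : 0 < c) : BddPos fun _ : X => c :=
  ⟨measurable_const, ⟨c, hc, fun _ => le_rfl⟩, c, fun _ => le_rfl⟩

theorem BddPos.inv (hf : BddPos f) : BddPos fun x => (f x)⁻¹ := by
  obtain ⟨a, ha, h⟩ := hf.lower
  obtain ⟨b, k⟩ := hf.upper
  refine ⟨hf.measurable.inv, ⟨(max b 1)⁻¹, by positivity, fun x => ?_⟩, a⁻¹, fun x => ?_⟩
  · exact inv_anti₀ (hf.pos x) ((k x).trans (le_max_left _ _))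
  · exact inv_anti₀ ha (h x)

theorem BddPos.div (hf : BddPos f) (hg : BddPos g) : BddPos fun x => f x / g x := by
  simpa only [div_eq_mul_inv] using hf.mul hg.inv

theorem BddPos.prod {ι : Type*} {F : ι → X → ℝ} (s : Finset ι)
    (h : ∀ i ∈ s, BddPos (F i)) : BddPos fun x => ∏ i ∈ s, F i x := by
  classical
  induction s using Finset.induction_on with
  | empty => simpa using BddPos.const (X := X) one_pos
  | insert i s hi ih =>
    simp only [Finset.prod_insert hi]
    exact (h i (by simp)).mul (ih fun j hj => h j (by simp [hj]))

theorem BddPos.comp (hf : BddPos f) {g : Y → X} (hg : Measurable g) :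
    BddPos fun y => f (g y) :=
  ⟨hf.measurable.comp hg, hf.lower.imp fun _ h => ⟨h.1, fun y => h.2 (g y)⟩,
    hf.upper.imp fun _ h y => h (g y)⟩

theorem BddPos.log (hf : BddPos f) : BddMeas fun x => Real.log (f x) := by
  obtain ⟨a, ha, h⟩ := hf.lower
  obtain ⟨b, k⟩ := hf.upper
  refine ⟨Real.measurable_log.comp hf.measurable, |Real.log a| + |Real.log b|, fun x => ?_⟩
  have h1 := Real.log_le_log ha (h x)
  have h2 := Real.log_le_log (hf.pos x) (k x)
  rw [abs_le]
  constructor <;>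
    linarith [neg_abs_le (Real.log a), le_abs_self (Real.log b), abs_nonneg (Real.log a),
      abs_nonneg (Real.log b)]

theorem BddPos.integral_right {f : X × Y → ℝ} (hf : BddPos f) (ν : Measure Y)
    [IsProbabilityMeasure ν] : BddPos fun x => ∫ y, f (x, y) ∂ν := by
  have hi : ∀ x, Integrable (fun y => f (x, y)) ν := fun x =>
    (hf.bddMeas.comp (measurable_prodMk_left (x := x))).integrable ν
  obtain ⟨a, ha, h⟩ := hf.lower
  obtain ⟨b, k⟩ := hf.upper
  refine ⟨hf.measurable.stronglyMeasurable.integral_prod_right'.measurable,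
    ⟨a, ha, fun x => ?_⟩, b, fun x => ?_⟩
  · simpa using integral_mono (integrable_const a) (hi x) fun y => h (x, y)
  · simpa using integral_mono (hi x) (integrable_const b) fun y => k (x, y)

end Bounded

/-- Jensen's inequality for the exponential function and the density `ρ`. -/
theorem exp_integral_mul_log_le {X : Type*} [MeasurableSpace X] {μ : Measure X}
    [IsFiniteMeasure μ] {ρ f : X → ℝ} (hρ : BddPos ρ) (hf : BddPos f) (h1 : ∫ x, ρ x ∂μ = 1) :
    Real.exp (∫ x, ρ x * Real.log (f x) ∂μ) ≤ ∫ x, ρ x * f x ∂μ := by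
  set m := ∫ x, ρ x * Real.log (f x) ∂μ with hm
  -- The tangent line of `exp` at `m`, evaluated at `log f` and weighted by `ρ`; integrating it
  -- gives the claim.
  have key : ∀ x, Real.exp m * (ρ x * Real.log (f x) + (1 - m) * ρ x) ≤ ρ x * f x := by
    intro x
    have h := Real.add_one_le_exp (Real.log (f x) - m)
    rw [Real.exp_sub, Real.exp_log (hf.pos x), le_div_iff₀ (Real.exp_pos m)] at h
    nlinarith [mul_le_mul_of_nonneg_left h (hρ.pos x).le]
  have hi := (hρ.bddMeas.mul hf.log).integrable μ
  have := integral_mono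
    ((hi.add ((hρ.bddMeas.integrable μ).const_mul (1 - m))).const_mul (Real.exp m))
    ((hρ.mul hf).bddMeas.integrable μ) key
  simp only [Pi.add_apply] at this
  rw [integral_const_mul, integral_add hi ((hρ.bddMeas.integrable μ).const_mul _),
    integral_const_mul, h1, ← hm] at this
  simpa using this

/-! ### Restricting and resampling independent points -/

section Reindex

variable {Ω : Type*} [MeasurableSpace Ω] (μ : Measure Ω) [IsProbabilityMeasure μ]

/-- Restricting independent points to some of the coordinates gives independent points. -/
theorem measurePreserving_comp_injective {A B : Type*} [Fintype A] [Fintype B] {f : A → B}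
    (hf : Function.Injective f) :
    MeasurePreserving (fun x : B → Ω => x ∘ f) (Measure.pi fun _ => μ)
      (Measure.pi fun _ => μ) := by
  classical
  have hm : Measurable (fun x : B → Ω => x ∘ f) :=
    measurable_pi_iff.2 fun a => measurable_pi_apply (f a)
  refine ⟨hm, (Measure.pi_eq fun s hs => ?_).symm⟩
  rw [Measure.map_apply hm (MeasurableSet.univ_pi hs)]
  have : (fun x : B → Ω => x ∘ f) ⁻¹' Set.univ.pi s =
      Set.univ.pi fun b => ⋂ (a) (_ : f a = b), s a := by
    ext x
    simp only [Set.mem_preimage, Set.mem_pi, Set.mem_univ, true_imp_iff, Function.comp_apply,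
      Set.mem_iInter]
    exact ⟨fun h b a e => e ▸ h a, fun h a => h _ a rfl⟩
  rw [this, Measure.pi_pi, ← Finset.prod_subset (Finset.subset_univ (Finset.univ.image f)),
    Finset.prod_image hf.injOn]
  · refine Finset.prod_congr rfl fun a _ => ?_
    congr 1
    ext y
    simp [hf.eq_iff]
  · intro b _ hb
    have : (⋂ (a) (_ : f a = b), s a) = Set.univ := by
      simp only [Finset.mem_image, Finset.mem_univ, true_and, not_exists] at hb
      simp [hb]
    rw [this, measure_univ]

variable {U : Type*}

open Classical in
/-- The configuration that agrees with `z` on `C` and with `x` elsewhere. -/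
noncomputable def glue {Ω U : Type*} (C : Set U) (x z : U → Ω) : U → Ω :=
  fun v => if v ∈ C then z v else x v

theorem measurable_glue (C : Set U) :
    Measurable fun q : (U → Ω) × (U → Ω) => glue C q.1 q.2 := by
  refine measurable_pi_iff.2 fun v => ?_
  unfold glue
  by_cases h : v ∈ C <;> simp only [h, if_true, if_false] <;> fun_prop

theorem measurePreserving_glue [Fintype U] (C : Set U) :
    MeasurePreserving (fun q : (U → Ω) × (U → Ω) => glue C q.1 q.2)
      ((Measure.pi fun _ => μ).prod (Measure.pi fun _ => μ)) (Measure.pi fun _ => μ) := by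
  classical
  refine ⟨measurable_glue C, (Measure.pi_eq fun s hs => ?_).symm⟩
  rw [Measure.map_apply (measurable_glue C) (MeasurableSet.univ_pi hs)]
  have : (fun q : (U → Ω) × (U → Ω) => glue C q.1 q.2) ⁻¹' Set.univ.pi s =
      (Set.univ.pi fun v => if v ∈ C then Set.univ else s v) ×ˢ
      (Set.univ.pi fun v => if v ∈ C then s v else Set.univ) := by
    ext ⟨x, z⟩
    simp only [Set.mem_preimage, Set.mem_pi, Set.mem_univ, true_imp_iff, glue, Set.mem_prod,
      ← forall_and]
    refine forall_congr' fun v => ?_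
    by_cases h : v ∈ C <;> simp [h]
  rw [this, Measure.prod_prod, Measure.pi_pi, Measure.pi_pi, ← Finset.prod_mul_distrib]
  refine Finset.prod_congr rfl fun v _ => ?_
  by_cases h : v ∈ C <;> simp [h]

/-- Resampling the coordinates in `C` independently does not change the joint law; this isolates the
inner average over `C`. -/
theorem integral_glue [Fintype U] (C : Set U) {F : (U → Ω) → ℝ} (hF : BddMeas F) :
    ∫ x, F x ∂(Measure.pi fun _ => μ) =
      ∫ x, ∫ z, F (glue C x z) ∂(Measure.pi fun _ => μ) ∂(Measure.pi fun _ => μ) := by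
  have h := measurePreserving_glue μ C
  rw [← h.map_eq, integral_map h.measurable.aemeasurable
    hF.measurable.aestronglyMeasurable, h.map_eq]
  exact integral_prod (fun q : (U → Ω) × (U → Ω) => F (glue C q.1 q.2))
    ((hF.comp h.measurable).integrable _)

end Reindex

/-! ### Growing subtrees of a tree leaf by leaf -/

section InducedEdges

variable {U : Type*} [Fintype U]

/-- The edges of `T` with both ends in `K`. -/
noncomputable def inducedEdges (T : SimpleGraph U) (K : Set U) : Finset (Sym2 U) :=
  (Set.toFinite {e | e ∈ T.edgeSet ∧ ∀ v ∈ e, v ∈ K}).toFinset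

variable {T : SimpleGraph U} {K : Set U}

theorem mk_mem_inducedEdges {u v : U} :
    s(u, v) ∈ inducedEdges T K ↔ T.Adj u v ∧ u ∈ K ∧ v ∈ K := by
  simp [inducedEdges]

theorem mem_of_mem_inducedEdges {e : Sym2 U} (he : e ∈ inducedEdges T K) {v : U} (hv : v ∈ e) :
    v ∈ K :=
  ((Set.Finite.mem_toFinset _).1 he).2 v hv

theorem inducedEdges_subset_univ : inducedEdges T K ⊆ inducedEdges T Set.univ := by
  intro e
  simp +contextual [inducedEdges]

theorem inducedEdges_singleton (v : U) : inducedEdges T {v} = ∅ := by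
  refine Finset.eq_empty_of_forall_notMem fun e => ?_
  induction e using Sym2.ind with
  | _ a b =>
    rw [mk_mem_inducedEdges]
    rintro ⟨h, rfl, rfl⟩
    exact h.ne rfl

theorem card_inducedEdges_add_one (hK : (T.induce K).IsTree) :
    (inducedEdges T K).card + 1 = K.ncard := by
  classical
  have h := hK.card_edgeFinset
  rw [← Nat.card_eq_fintype_card, Nat.card_coe_set_eq] at h
  rw [← h, ← Finset.card_image_of_injective (T.induce K).edgeFinset
    (Sym2.map.injective (Subtype.val_injective (p := (· ∈ K))))]
  congr 2
  ext e
  induction e using Sym2.ind with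
  | _ a b =>
    simp only [mk_mem_inducedEdges, Finset.mem_image, SimpleGraph.mem_edgeFinset]
    constructor
    · rintro ⟨h, ha, hb⟩
      exact ⟨s(⟨a, ha⟩, ⟨b, hb⟩), h, rfl⟩
    · rintro ⟨e, he, h⟩
      induction e using Sym2.ind with
      | _ c d =>
        have hcd : T.Adj c d := he
        rw [Sym2.map_mk, Sym2.eq_iff] at h
        rcases h with ⟨rfl, rfl⟩ | ⟨rfl, rfl⟩
        · exact ⟨hcd, c.2, d.2⟩
        · exact ⟨hcd.symm, d.2, c.2⟩

omit [Fintype U] in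
/-- In a forest, a vertex outside a connected set has at most one neighbour in it. -/
theorem SimpleGraph.IsAcyclic.eq_of_adj_of_connected (hT : T.IsAcyclic)
    (hK : (T.induce K).Connected) {v a b : U} (hv : v ∉ K) (ha : a ∈ K) (hb : b ∈ K)
    (hav : T.Adj a v) (hbv : T.Adj b v) : b = a := by
  obtain ⟨q, hq⟩ := hK.exists_isPath ⟨a, ha⟩ ⟨b, hb⟩
  let f := SimpleGraph.Embedding.induce (G := T) K
  have hq' : (q.map f.toHom).IsPath := hq.map f.injective
  have hp : (SimpleGraph.Walk.cons hav .nil).IsPath := by simp [hav.ne]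
  have hvs : v ∉ (q.map f.toHom).support := by
    rw [SimpleGraph.Walk.support_map]
    intro h
    obtain ⟨c, -, rfl⟩ := List.mem_map.1 h
    exact hv c.2
  -- The path from `a` to `b` inside `K` avoids `v`, so in a forest `b` must lie on the one-edge
  -- path from `a` to `v`.
  have := hT.mem_support_of_ne_mem_support_of_adj_of_isPath hp hq' hbv.symm hvs
  change b ∈ _ at this
  simp only [SimpleGraph.Walk.support_cons, SimpleGraph.Walk.support_nil, List.mem_cons,
    List.not_mem_nil, or_false] at this
  rcases this with h | h
  · exact h
  · exact absurd (h ▸ hb) hv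

open Classical in
/-- A proper connected set of vertices of a tree can be enlarged by a leaf. -/
theorem SimpleGraph.IsTree.exists_insert_leaf (hT : T.IsTree) (hK : (T.induce K).Connected)
    (hne : K ≠ Set.univ) :
    ∃ u ∈ K, ∃ v ∉ K, (T.induce (insert v K)).Connected ∧
      inducedEdges T (insert v K) = insert s(u, v) (inducedEdges T K) := by
  obtain ⟨w, hw⟩ := (Set.ne_univ_iff_exists_notMem K).1 hne
  obtain ⟨⟨k, hk⟩⟩ := hK.nonempty
  obtain ⟨p⟩ := hT.connected.preconnected k w
  -- A walk leaving `K` supplies the new leaf: its first vertex outside has only one neighbour in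
  -- `K`, by acyclicity.
  obtain ⟨⟨⟨u, v⟩, huv⟩, -, hu, hv⟩ := p.exists_boundary_dart K hk hw
  simp only at huv hu hv
  refine ⟨u, hu, v, hv, ?_, ?_⟩
  · rw [← Set.union_singleton]
    exact SimpleGraph.connected_induce_union hK.preconnected
      (SimpleGraph.IsTree.of_subsingleton).connected.preconnected hu rfl huv
  · ext e
    induction e using Sym2.ind with
    | _ a b =>
      simp only [Finset.mem_insert, mk_mem_inducedEdges, Set.mem_insert_iff, Sym2.eq_iff]
      have key : ∀ a ∈ K, T.Adj a v → a = u := fun a ha h =>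
        hT.isAcyclic.eq_of_adj_of_connected hK hv hu ha huv h
      constructor
      · rintro ⟨h, rfl | ha, rfl | hb⟩
        · exact (h.ne rfl).elim
        · exact .inl (.inr ⟨rfl, key b hb h.symm⟩)
        · exact .inl (.inl ⟨key a ha h, rfl⟩)
        · exact .inr ⟨h, ha, hb⟩
      · rintro ((⟨rfl, rfl⟩ | ⟨rfl, rfl⟩) | ⟨h, ha, hb⟩)
        · exact ⟨huv, .inr hu, .inl rfl⟩
        · exact ⟨huv.symm, .inl rfl, .inr hu⟩
        · exact ⟨h, .inr ha, .inr hb⟩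

end InducedEdges

/-! ### The branching random walk and its logarithmic bounds -/

namespace Graphon

variable {Ω U : Type*} [MeasurableSpace Ω] (W : Graphon Ω) (μ : Measure Ω)

/-- The degree function of a graphon. -/
noncomputable def deg (a : Ω) : ℝ := ∫ b, W.toFun a b ∂μ

/-- The edge density of a graphon. -/
noncomputable def density : ℝ := ∫ a, W.deg μ a ∂μ

/-- The product of the degrees of the two ends of an edge. -/
noncomputable def edgeDeg (x : U → Ω) : Sym2 U → ℝ :=
  Sym2.lift ⟨fun u v => W.deg μ (x u) * W.deg μ (x v), fun _ _ => mul_comm _ _⟩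

/-- The product of the values of a graphon over a set of edges. -/
noncomputable def edgeProd (E : Finset (Sym2 U)) (x : U → Ω) : ℝ := ∏ e ∈ E, W.edgeValue x e

variable [Fintype U] (T : SimpleGraph U) (K : Set U)

/-- The product of `W` over the edges of `T[K]`, divided by the density of the branching random
walk on the tree `T[K]`. -/
noncomputable def ratio (x : U → Ω) : ℝ :=
  W.density μ * (∏ e ∈ inducedEdges T K, W.edgeDeg μ x e) / ∏ v ∈ K.toFinite.toFinset, W.deg μ (x v)

/-- The density of the branching random walk on the tree `T[K]`. -/
noncomputable def branching (x : U → Ω) : ℝ :=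
  W.edgeProd (inducedEdges T K) x / W.ratio μ T K x

variable {W μ T K} {ε : ℝ}

omit [Fintype U] in
theorem edgeProd_congr {E : Finset (Sym2 U)} {x y : U → Ω} (h : ∀ e ∈ E, ∀ v ∈ e, x v = y v) :
    W.edgeProd E x = W.edgeProd E y := by
  refine Finset.prod_congr rfl fun e he => ?_
  have := h e he
  induction e using Sym2.ind with
  | _ a b =>
    change W.toFun _ _ = W.toFun _ _
    rw [this a (by simp), this b (by simp)]

theorem branching_congr {x y : U → Ω} (h : ∀ v ∈ K, x v = y v) :
    W.branching μ T K x = W.branching μ T K y := by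
  classical
  unfold branching ratio
  rw [edgeProd_congr fun e he v hv => h v (mem_of_mem_inducedEdges he hv)]
  congr 2
  · congr 1
    refine Finset.prod_congr rfl fun e he => ?_
    have := fun v (hv : v ∈ e) => h v (mem_of_mem_inducedEdges he hv)
    induction e using Sym2.ind with
    | _ a b =>
      change W.deg μ _ * W.deg μ _ = W.deg μ _ * W.deg μ _
      rw [this a (by simp), this b (by simp)]
  · exact Finset.prod_congr rfl fun v hv => by rw [h v ((Set.Finite.mem_toFinset _).1 hv)]

theorem bddPos_uncurry (hε : 0 < ε) (hW : ∀ a b, ε ≤ W.toFun a b) :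
    BddPos (Function.uncurry W.toFun) :=
  ⟨W.measurable_toFun, ⟨ε, hε, fun q => hW q.1 q.2⟩, 1, fun q => W.le_one q.1 q.2⟩

variable [IsProbabilityMeasure μ]

theorem bddPos_deg (hε : 0 < ε) (hW : ∀ a b, ε ≤ W.toFun a b) : BddPos (W.deg μ) :=
  (bddPos_uncurry hε hW).integral_right μ

theorem density_pos (hε : 0 < ε) (hW : ∀ a b, ε ≤ W.toFun a b) : 0 < W.density μ := by
  have h := bddPos_deg (μ := μ) hε hW
  obtain ⟨a, ha, hd⟩ := h.lower
  refine ha.trans_le ?_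
  rw [density]
  simpa using integral_mono (integrable_const a) (h.bddMeas.integrable μ) hd

omit [Fintype U] in
theorem bddPos_edgeProd (hε : 0 < ε) (hW : ∀ a b, ε ≤ W.toFun a b) (E : Finset (Sym2 U)) :
    BddPos (W.edgeProd E) := by
  refine BddPos.prod E fun e _ => ?_
  induction e using Sym2.ind with
  | _ a b =>
    exact (bddPos_uncurry hε hW).comp (g := fun x : U → Ω => (x a, x b))
      ((measurable_pi_apply a).prodMk (measurable_pi_apply b))

omit [Fintype U] in
theorem bddPos_edgeDeg (hε : 0 < ε) (hW : ∀ a b, ε ≤ W.toFun a b) (e : Sym2 U) :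
    BddPos fun x => W.edgeDeg μ x e := by
  induction e using Sym2.ind with
  | _ a b =>
    exact ((bddPos_deg hε hW).comp (measurable_pi_apply a)).mul
      ((bddPos_deg hε hW).comp (measurable_pi_apply b))

theorem bddPos_ratio (hε : 0 < ε) (hW : ∀ a b, ε ≤ W.toFun a b) : BddPos (W.ratio μ T K) :=
  ((BddPos.const (density_pos hε hW)).mul
    (BddPos.prod _ fun e _ => bddPos_edgeDeg hε hW e)).div
    (BddPos.prod _ fun v _ => (bddPos_deg hε hW).comp (measurable_pi_apply v))

theorem bddPos_branching (hε : 0 < ε) (hW : ∀ a b, ε ≤ W.toFun a b) :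
    BddPos (W.branching μ T K) :=
  (bddPos_edgeProd hε hW _).div (bddPos_ratio hε hW)

/-- A new leaf `v` at `u` costs one step of the walk: its own degree cancels in the ratio, and
`d(x_u)` gains one power. -/
theorem branching_insert (hε : 0 < ε) (hW : ∀ a b, ε ≤ W.toFun a b) {u v : U} (hv : v ∉ K)
    (hE : ∀ [DecidableEq U], inducedEdges T (insert v K) = insert s(u, v) (inducedEdges T K))
    (x : U → Ω) :
    W.branching μ T (insert v K) x =
      W.branching μ T K x * (W.deg μ (x u))⁻¹ * W.toFun (x u) (x v) := by
  classical
  have h1 : s(u, v) ∉ inducedEdges T K := fun h => hv (mem_of_mem_inducedEdges h (by simp))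
  have hv' := ((bddPos_deg (μ := μ) hε hW).pos (x v)).ne'
  have hr : W.ratio μ T (insert v K) x = W.ratio μ T K x * W.deg μ (x u) := by
    unfold ratio
    have hi : (insert v K).toFinite.toFinset = insert v K.toFinite.toFinset := by ext; simp
    rw [hE, Finset.prod_insert h1, hi, Finset.prod_insert (by simpa using hv)]
    change _ * (W.deg μ (x u) * W.deg μ (x v) * _) / _ = _
    rw [show ∀ p a b e d : ℝ, p * (a * b * e) / (b * d) = b * (p * e * a) / (b * d) by
      intros; ring, mul_div_mul_left _ _ hv']
    ring
  have he : W.edgeProd (inducedEdges T (insert v K)) x =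
      W.toFun (x u) (x v) * W.edgeProd (inducedEdges T K) x := by
    unfold edgeProd
    rw [hE, Finset.prod_insert h1]
    rfl
  unfold branching
  rw [hr, he, div_eq_mul_inv, mul_inv, div_eq_mul_inv]
  ring

/-- The transition density `W(x_u, ·) / d(x_u)` integrates to 1, so averaging over the new leaf
removes it. -/
theorem integral_branching_insert_mul (hε : 0 < ε) (hW : ∀ a b, ε ≤ W.toFun a b) {u v : U}
    (hu : u ∈ K) (hv : v ∉ K)
    (hE : ∀ [DecidableEq U], inducedEdges T (insert v K) = insert s(u, v) (inducedEdges T K))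
    {F : (U → Ω) → ℝ} (hF : BddMeas F) (hloc : ∀ x y, (∀ w ∈ K, x w = y w) → F x = F y) :
    ∫ x, W.branching μ T (insert v K) x * F x ∂(Measure.pi fun _ => μ) =
      ∫ x, W.branching μ T K x * F x ∂(Measure.pi fun _ => μ) := by
  rw [integral_glue μ {v} ((bddPos_branching hε hW).bddMeas.mul hF)]
  refine integral_congr_ae (.of_forall fun x => ?_)
  have hg : ∀ z, ∀ w ∈ K, glue {v} x z w = x w := fun z w hw =>
    if_neg fun h : w = v => hv (h ▸ hw)
  have hgv : ∀ z : U → Ω, glue {v} x z v = z v := fun z => if_pos rfl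
  have : ∀ z, W.branching μ T (insert v K) (glue {v} x z) * F (glue {v} x z) =
      W.branching μ T K x * F x * (W.deg μ (x u))⁻¹ * W.toFun (x u) (z v) := by
    intro z
    rw [branching_insert hε hW hv hE, branching_congr (hg z), hloc _ _ (hg z), hg z u hu, hgv]
    ring
  simp only [this]
  rw [integral_const_mul, integral_comp_eval (μ := fun _ : U => μ) (i := v)
    (f := fun b => W.toFun (x u) b)
    (W.measurable_toFun.comp measurable_prodMk_left).aestronglyMeasurable]
  change _ * W.deg μ (x u) = _
  rw [inv_mul_cancel_right₀ ((bddPos_deg hε hW).pos _).ne']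

/-- The marginal on a subtree of the branching random walk on a tree is the branching random walk
on the subtree. -/
theorem integral_branching_univ_mul (hε : 0 < ε) (hW : ∀ a b, ε ≤ W.toFun a b) (hT : T.IsTree)
    (hK : (T.induce K).Connected)
    {F : (U → Ω) → ℝ} (hF : BddMeas F) (hloc : ∀ x y, (∀ w ∈ K, x w = y w) → F x = F y) :
    ∫ x, W.branching μ T Set.univ x * F x ∂(Measure.pi fun _ => μ) =
      ∫ x, W.branching μ T K x * F x ∂(Measure.pi fun _ => μ) := by
  -- Induction on the number of vertices outside `K`: adding a leaf to `K` leaves the integral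
  -- unchanged.
  induction hn : Kᶜ.ncard generalizing K with
  | zero =>
    rw [Set.ncard_eq_zero, Set.compl_empty_iff] at hn
    rw [hn]
  | succ n ih =>
    have hne : K ≠ Set.univ := by
      rintro rfl
      simp at hn
    obtain ⟨u, hu, v, hv, hc, hE⟩ := hT.exists_insert_leaf hK hne
    rw [ih hc (fun x y h => hloc x y fun w hw => h w (.inr hw)),
      integral_branching_insert_mul hε hW hu hv (by intro _; convert hE) hF hloc]
    rw [← Set.union_singleton, Set.compl_union, ← Set.sdiff_eq,
      Set.ncard_sdiff_singleton_of_mem hv, hn, Nat.add_sub_cancel]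

/-- Consistency of marginals, used upwards from `K` to `T` and then downwards to `{v}`, shows that
every vertex has law `d / p`. -/
theorem integral_branching_mul_eval (hε : 0 < ε) (hW : ∀ a b, ε ≤ W.toFun a b) (hT : T.IsTree)
    (hK : (T.induce K).Connected) {v : U} (hv : v ∈ K) {g : Ω → ℝ} (hg : BddMeas g) :
    ∫ x, W.branching μ T K x * g (x v) ∂(Measure.pi fun _ => μ) =
      (∫ a, W.deg μ a * g a ∂μ) / W.density μ := by
  classical
  have hF : BddMeas fun x : U → Ω => g (x v) := hg.comp (measurable_pi_apply v)
  rw [← integral_branching_univ_mul hε hW hT hK hF fun x y h => by rw [h v hv],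
    integral_branching_univ_mul (K := {v}) hε hW hT
      (SimpleGraph.IsTree.of_subsingleton).connected hF fun x y h => by rw [h v rfl]]
  have : ∀ x : U → Ω, W.branching μ T {v} x * g (x v) =
      (fun a => W.deg μ a * g a / W.density μ) (x v) := by
    intro x
    simp only [branching, ratio, edgeProd, inducedEdges_singleton, Finset.prod_empty,
      Set.Finite.toFinset_singleton, Finset.prod_singleton]
    rw [mul_one, one_div_div]
    ring
  simp only [this]
  rw [integral_comp_eval (μ := fun _ : U => μ) (i := v)
    (f := fun a => W.deg μ a * g a / W.density μ), integral_div]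
  exact (((bddPos_deg hε hW).bddMeas.mul hg).measurable.div_const _).aestronglyMeasurable

theorem integral_branching (hε : 0 < ε) (hW : ∀ a b, ε ≤ W.toFun a b) (hT : T.IsTree)
    (hK : (T.induce K).Connected) :
    ∫ x, W.branching μ T K x ∂(Measure.pi fun _ => μ) = 1 := by
  obtain ⟨⟨v, hv⟩⟩ := hK.nonempty
  have := integral_branching_mul_eval (μ := μ) hε hW hT hK hv (BddMeas.const 1)
  simp only [mul_one] at this
  rw [this]
  exact div_self (density_pos hε hW).ne'

/-- Jensen for the function `1 / d` under the density `d / p`, whose mean is `1 / p`. -/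
theorem log_density_le (hε : 0 < ε) (hW : ∀ a b, ε ≤ W.toFun a b) :
    Real.log (W.density μ) ≤ (∫ a, W.deg μ a * Real.log (W.deg μ a) ∂μ) / W.density μ := by
  have hp := density_pos (μ := μ) hε hW
  have hd := bddPos_deg (μ := μ) hε hW
  have := exp_integral_mul_log_le (μ := μ) (hd.div (BddPos.const hp)) hd.inv
    (by rw [integral_div]; exact div_self hp.ne')
  have h1 : ∀ a, W.deg μ a / W.density μ * (W.deg μ a)⁻¹ = (W.density μ)⁻¹ := fun a => by
    rw [div_mul_eq_mul_div, mul_inv_cancel₀ (hd.pos a).ne', one_div]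
  have h2 : ∀ a, W.deg μ a / W.density μ * Real.log (W.deg μ a)⁻¹ =
      - (W.deg μ a * Real.log (W.deg μ a) / W.density μ) := fun a => by
    rw [Real.log_inv]; ring
  simp only [h1, h2] at this
  rw [integral_neg, integral_div, integral_const, probReal_univ, one_smul,
    ← Real.le_log_iff_exp_le (inv_pos.2 hp), Real.log_inv] at this
  linarith

/-- With `e` edges, `e + 1` vertices and `D = E log d`, the right side is `log p + 2eD - (e + 1)D =
log p + (e - 1)D`. Since `D ≥ log p`, this is at least `e log p` as soon as `e ≥ 1`; without edges
the inequality `D ≥ log p` would point the wrong way. -/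
theorem card_mul_log_density_le (hε : 0 < ε) (hW : ∀ a b, ε ≤ W.toFun a b) (hT : T.IsTree)
    (hK : (T.induce K).IsTree) (hne : (inducedEdges T K).Nonempty) :
    (inducedEdges T K).card * Real.log (W.density μ) ≤
      ∫ x, W.branching μ T K x * Real.log (W.ratio μ T K x) ∂(Measure.pi fun _ => μ) := by
  classical
  set D := (∫ a, W.deg μ a * Real.log (W.deg μ a) ∂μ) / W.density μ with hD
  have hp := density_pos (μ := μ) hε hW
  have hd := bddPos_deg (μ := μ) hε hW
  have hτ := (bddPos_branching (μ := μ) (T := T) (K := K) hε hW).bddMeas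
  have hv : ∀ v ∈ K, ∫ x, W.branching μ T K x * Real.log (W.deg μ (x v))
      ∂(Measure.pi fun _ => μ) = D := fun v hv =>
    integral_branching_mul_eval hε hW hT hK.connected hv hd.log
  have hlogv : ∀ v : U, BddMeas fun x : U → Ω => Real.log (W.deg μ (x v)) :=
    fun v => hd.log.comp (measurable_pi_apply v)
  have hloge : ∀ e : Sym2 U, BddMeas fun x : U → Ω => Real.log (W.edgeDeg μ x e) :=
    fun e => (bddPos_edgeDeg hε hW e).log
  have he : ∀ e ∈ inducedEdges T K, ∫ x, W.branching μ T K x * Real.log (W.edgeDeg μ x e)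
      ∂(Measure.pi fun _ => μ) = 2 * D := by
    intro e he
    have hm := fun v (hv : v ∈ e) => mem_of_mem_inducedEdges he hv
    induction e using Sym2.ind with
    | _ a b =>
      have : ∀ x : U → Ω, W.branching μ T K x * Real.log (W.edgeDeg μ x s(a, b)) =
          W.branching μ T K x * Real.log (W.deg μ (x a)) +
          W.branching μ T K x * Real.log (W.deg μ (x b)) := fun x => by
        change _ * Real.log (W.deg μ (x a) * W.deg μ (x b)) = _
        rw [Real.log_mul (hd.pos _).ne' (hd.pos _).ne', mul_add]
      simp only [this]
      rw [integral_add ((hτ.mul (hlogv a)).integrable _) ((hτ.mul (hlogv b)).integrable _),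
        hv a (hm a (by simp)), hv b (hm b (by simp)), two_mul]
  have hlog : ∀ x, W.branching μ T K x * Real.log (W.ratio μ T K x) =
      Real.log (W.density μ) * W.branching μ T K x +
      ∑ e ∈ inducedEdges T K, W.branching μ T K x * Real.log (W.edgeDeg μ x e) -
      ∑ v ∈ K.toFinite.toFinset, W.branching μ T K x * Real.log (W.deg μ (x v)) := by
    intro x
    have h1 : ∀ e ∈ inducedEdges T K, W.edgeDeg μ x e ≠ 0 := fun e _ =>
      ((bddPos_edgeDeg hε hW e).pos x).ne'
    have h2 : ∀ v ∈ K.toFinite.toFinset, W.deg μ (x v) ≠ 0 := fun v _ => (hd.pos _).ne'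
    rw [ratio, Real.log_div (mul_ne_zero hp.ne' (Finset.prod_ne_zero_iff.2 h1))
      (Finset.prod_ne_zero_iff.2 h2), Real.log_mul hp.ne' (Finset.prod_ne_zero_iff.2 h1),
      Real.log_prod h1, Real.log_prod h2, ← Finset.mul_sum, ← Finset.mul_sum]
    ring
  simp only [hlog]
  have hsE := BddMeas.sum (inducedEdges T K) fun e _ => hτ.mul (hloge e)
  have hsV := BddMeas.sum K.toFinite.toFinset fun v _ => hτ.mul (hlogv v)
  rw [integral_sub ((((BddMeas.const _).mul hτ).add hsE).integrable _) (hsV.integrable _),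
    integral_add (((BddMeas.const _).mul hτ).integrable _) (hsE.integrable _),
    integral_const_mul, integral_branching hε hW hT hK.connected,
    integral_finsetSum _ fun e _ => (hτ.mul (hloge e)).integrable _,
    integral_finsetSum _ fun v _ => (hτ.mul (hlogv v)).integrable _,
    Finset.sum_congr rfl he, Finset.sum_congr rfl fun v h => hv v ((Set.Finite.mem_toFinset _).1 h),
    Finset.sum_const, Finset.sum_const, ← Set.ncard_eq_toFinset_card,
    ← card_inducedEdges_add_one hK]
  have hle : Real.log (W.density μ) ≤ D := log_density_le hε hW
  have h1 : (1 : ℝ) ≤ (inducedEdges T K).card := by exact_mod_cast hne.card_pos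
  simp only [nsmul_eq_mul]
  push_cast
  nlinarith [mul_le_mul_of_nonneg_left hle (sub_nonneg.2 h1)]

variable (W μ T K) in
/-- The density of `T[K]` in `W` with the vertices outside `C` placed at the points of `x`. -/
noncomputable def rooted (C : Set U) (x : U → Ω) : ℝ :=
  ∫ z, W.edgeProd (inducedEdges T K) (glue C x z) ∂(Measure.pi fun _ => μ)

theorem bddPos_rooted (hε : 0 < ε) (hW : ∀ a b, ε ≤ W.toFun a b) (C : Set U) :
    BddPos (W.rooted μ T K C) :=
  BddPos.integral_right ((bddPos_edgeProd hε hW _).comp (measurable_glue C)) _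

omit [IsProbabilityMeasure μ] in
theorem rooted_glue (C : Set U) (x z : U → Ω) :
    W.rooted μ T K C (glue C x z) = W.rooted μ T K C x := by
  unfold rooted
  congr! 3 with y
  funext v
  by_cases h : v ∈ C <;> simp [glue, h]

omit [IsProbabilityMeasure μ] in
theorem rooted_congr (C : Set U) {x y : U → Ω} (h : ∀ v ∈ K, x v = y v) :
    W.rooted μ T K C x = W.rooted μ T K C y := by
  unfold rooted
  congr! 2 with z
  refine edgeProd_congr fun e he v hv => ?_
  simp only [glue, h v (mem_of_mem_inducedEdges he hv)]

/-- Resample the points of `C`: the denominator does not depend on them, and the numerator averages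
to the denominator. -/
theorem integral_edgeProd_div_rooted (hε : 0 < ε) (hW : ∀ a b, ε ≤ W.toFun a b) (C : Set U) :
    ∫ x, W.edgeProd (inducedEdges T K) x / W.rooted μ T K C x ∂(Measure.pi fun _ => μ) = 1 := by
  have hr := bddPos_rooted (μ := μ) (T := T) (K := K) hε hW C
  rw [integral_glue μ C ((bddPos_edgeProd hε hW _).div hr).bddMeas]
  simp only [rooted_glue]
  have : ∀ x, ∫ z, W.edgeProd (inducedEdges T K) (glue C x z) / W.rooted μ T K C x
      ∂(Measure.pi fun _ => μ) = 1 := fun x => by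
    rw [integral_div]
    exact div_self (hr.pos x).ne'
  simp [this]

/-- Nonnegativity of relative entropy: `∏ W / R` is a probability density, and its quotient by the
walk density is `q / R`, so Jensen gives `E log (q / R) ≤ 0`. -/
theorem integral_log_ratio_le_integral_log_rooted (hε : 0 < ε) (hW : ∀ a b, ε ≤ W.toFun a b)
    (hT : T.IsTree) (hK : (T.induce K).Connected) (C : Set U) :
    ∫ x, W.branching μ T K x * Real.log (W.ratio μ T K x) ∂(Measure.pi fun _ => μ) ≤
      ∫ x, W.branching μ T K x * Real.log (W.rooted μ T K C x) ∂(Measure.pi fun _ => μ) := by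
  have hr := bddPos_rooted (μ := μ) (T := T) (K := K) hε hW C
  have hq := bddPos_ratio (μ := μ) (T := T) (K := K) hε hW
  have hτ := bddPos_branching (μ := μ) (T := T) (K := K) hε hW
  have := exp_integral_mul_log_le hτ (hq.div hr) (integral_branching hε hW hT hK)
  have h1 : ∀ x, W.branching μ T K x * (W.ratio μ T K x / W.rooted μ T K C x) =
      W.edgeProd (inducedEdges T K) x / W.rooted μ T K C x := fun x => by
    rw [branching, ← mul_div_assoc, div_mul_cancel₀ _ (hq.pos x).ne']
  have h2 : ∀ x, W.branching μ T K x * Real.log (W.ratio μ T K x / W.rooted μ T K C x) =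
      W.branching μ T K x * Real.log (W.ratio μ T K x) -
      W.branching μ T K x * Real.log (W.rooted μ T K C x) := fun x => by
    rw [Real.log_div (hq.pos x).ne' (hr.pos x).ne', mul_sub]
  simp only [h1, h2] at this
  rw [integral_edgeProd_div_rooted hε hW, Real.exp_le_one_iff,
    integral_sub ((hτ.bddMeas.mul hq.log).integrable _)
      ((hτ.bddMeas.mul hr.log).integrable _)] at this
  linarith

/-- The heart of the proof: Jensen under the walk on all of `T`. Each factor `R_i` sees only the
points of `K i`, so its logarithm may be averaged under the walk on `T[K i]`. -/
theorem pow_density_le_integral (hε : 0 < ε) (hW : ∀ a b, ε ≤ W.toFun a b) (hT : T.IsTree)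
    {ι : Type*} [Fintype ι] {K C : ι → Set U} (hK : ∀ i, (T.induce (K i)).IsTree) :
    W.density μ ^ ((inducedEdges T Set.univ).card + ∑ i, (inducedEdges T (K i)).card) ≤
      ∫ x, W.edgeProd (inducedEdges T Set.univ) x * ∏ i, W.rooted μ T (K i) (C i) x
        ∂(Measure.pi fun _ => μ) := by
  have hp := density_pos (μ := μ) hε hW
  have hempty : ∀ K C : Set U, inducedEdges T K = ∅ → ∀ x, W.rooted μ T K C x = 1 := by
    intro K C h x
    simp [rooted, h, edgeProd]
  -- Edgeless trees are set aside, as the bound on `E log q` needs an edge; both sides are then 1.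
  rcases (inducedEdges T Set.univ).eq_empty_or_nonempty with h0 | h0
  · have h0' : ∀ i, inducedEdges T (K i) = ∅ := fun i =>
      Finset.subset_empty.1 (h0 ▸ inducedEdges_subset_univ)
    simp [h0, h0', hempty _ _ (h0' _), edgeProd]
  have huniv : (T.induce Set.univ).IsTree :=
    (SimpleGraph.induceUnivIso T).isTree_iff.2 hT
  have hr : ∀ i, BddPos (W.rooted μ T (K i) (C i)) := fun i => bddPos_rooted hε hW _
  have hq := bddPos_ratio (μ := μ) (T := T) (K := Set.univ) hε hW
  have hτ := bddPos_branching (μ := μ) (T := T) (K := Set.univ) hε hW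
  have hX := BddPos.prod Finset.univ fun i _ => hr i
  have hi : ∀ i, (inducedEdges T (K i)).card * Real.log (W.density μ) ≤
      ∫ x, W.branching μ T Set.univ x * Real.log (W.rooted μ T (K i) (C i) x)
        ∂(Measure.pi fun _ => μ) := by
    intro i
    rcases (inducedEdges T (K i)).eq_empty_or_nonempty with h | h
    · simp [h, hempty _ _ h]
    · rw [integral_branching_univ_mul hε hW hT (hK i).connected (hr i).log
        fun x y h => by rw [rooted_congr _ h]]
      exact (card_mul_log_density_le hε hW hT (hK i) h).trans
        (integral_log_ratio_le_integral_log_rooted hε hW hT (hK i).connected _)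
  have := exp_integral_mul_log_le hτ (hq.mul hX) (integral_branching hε hW hT huniv.connected)
  have h1 : ∀ x, W.branching μ T Set.univ x *
      (W.ratio μ T Set.univ x * ∏ i, W.rooted μ T (K i) (C i) x) =
      W.edgeProd (inducedEdges T Set.univ) x * ∏ i, W.rooted μ T (K i) (C i) x := fun x => by
    rw [branching, ← mul_assoc, div_mul_cancel₀ _ (hq.pos x).ne']
  have h2 : ∀ x, W.branching μ T Set.univ x *
      Real.log (W.ratio μ T Set.univ x * ∏ i, W.rooted μ T (K i) (C i) x) =
      W.branching μ T Set.univ x * Real.log (W.ratio μ T Set.univ x) +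
      ∑ i, W.branching μ T Set.univ x * Real.log (W.rooted μ T (K i) (C i) x) := fun x => by
    rw [Real.log_mul (hq.pos x).ne' (hX.pos x).ne',
      Real.log_prod fun i _ => ((hr i).pos x).ne', mul_add, Finset.mul_sum]
  simp only [h1, h2] at this
  refine le_trans ?_ this
  rw [integral_add ((hτ.bddMeas.mul hq.log).integrable _)
    ((BddMeas.sum _ fun i _ => hτ.bddMeas.mul (hr i).log).integrable _),
    integral_finsetSum _ fun i _ => (hτ.bddMeas.mul (hr i).log).integrable _]
  rw [← Real.log_le_iff_le_exp (pow_pos hp _), Real.log_pow]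
  push_cast
  rw [add_mul, Finset.sum_mul]
  exact add_le_add (card_mul_log_density_le hε hW hT huniv h0) (Finset.sum_le_sum fun i _ => hi i)

end Graphon

/-! ### Edges of a reflection graph -/

section ReflectionGraph

variable {U ι : Type*} {T : SimpleGraph U} {K S : ι → Set U}

open Classical in
/-- The vertex of the reflection graph that corresponds to `v` in the `i`-th copy of `T[K i]`. -/
noncomputable def copyVertex (K S : ι → Set U) (i : ι) (v : U) : U ⊕ (Σ i, ↥(K i \ S i)) :=
  if h : v ∈ K i \ S i then .inr ⟨i, v, h⟩ else .inl v

theorem copyVertex_of_mem {i : ι} {v : U} (h : v ∈ K i \ S i) :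
    copyVertex K S i v = .inr ⟨i, v, h⟩ := dif_pos h

theorem copyVertex_of_mem_right {i : ι} {v : U} (h : v ∈ S i) :
    copyVertex K S i v = .inl v := dif_neg fun h' => h'.2 h

theorem copyVertex_injective (i : ι) : Function.Injective (copyVertex K S i) := by
  intro a b h
  unfold copyVertex at h
  split_ifs at h with ha hb hb <;> simp_all

theorem reflectionGraph_colorable {n : ℕ} (h : T.Colorable n) :
    (reflectionGraph T K S).Colorable n := by
  obtain ⟨c⟩ := h
  refine ⟨⟨Sum.elim c fun q => c q.2, ?_⟩⟩
  rintro (x | ⟨i, x⟩) (y | ⟨j, y⟩) hxy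
  · exact c.map_rel hxy
  · exact c.map_rel hxy.2
  · exact c.map_rel hxy.2
  · exact c.map_rel hxy.2

variable [Fintype U] [Fintype ι]

open Classical in
theorem reflectionGraph_edgeFinset (hS : ∀ i, S i ⊆ K i) :
    (reflectionGraph T K S).edgeFinset =
      (inducedEdges T Set.univ).image (Sym2.map Sum.inl) ∪
        Finset.univ.biUnion fun i => (inducedEdges T (K i)).image (Sym2.map (copyVertex K S i)) := by
  ext e
  simp only [Finset.mem_union, Finset.mem_biUnion, Finset.mem_image, Finset.mem_univ, true_and,
    SimpleGraph.mem_edgeFinset]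
  constructor
  · intro he
    induction e using Sym2.ind with
    | _ a b =>
      rw [SimpleGraph.mem_edgeSet] at he
      rcases a with x | ⟨i, x⟩ <;> rcases b with y | ⟨j, y⟩
      · exact .inl ⟨s(x, y), mk_mem_inducedEdges.2 ⟨he, trivial, trivial⟩, rfl⟩
      · refine .inr ⟨j, s(x, y), mk_mem_inducedEdges.2 ⟨he.2, hS j he.1, y.2.1⟩, ?_⟩
        rw [Sym2.map_mk, copyVertex_of_mem_right he.1, copyVertex_of_mem y.2]
      · refine .inr ⟨i, s(x, y), mk_mem_inducedEdges.2 ⟨he.2, x.2.1, hS i he.1⟩, ?_⟩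
        rw [Sym2.map_mk, copyVertex_of_mem_right he.1, copyVertex_of_mem x.2]
      · obtain ⟨rfl, h⟩ := he
        refine .inr ⟨i, s(x, y), mk_mem_inducedEdges.2 ⟨h, x.2.1, y.2.1⟩, ?_⟩
        rw [Sym2.map_mk, copyVertex_of_mem x.2, copyVertex_of_mem y.2]
  · rintro (⟨e, he, rfl⟩ | ⟨i, e, he, rfl⟩)
    · induction e using Sym2.ind with
      | _ a b => exact (mk_mem_inducedEdges.1 he).1
    · induction e using Sym2.ind with
      | _ a b =>
        obtain ⟨h, ha, hb⟩ := mk_mem_inducedEdges.1 he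
        rw [Sym2.map_mk, SimpleGraph.mem_edgeSet]
        by_cases ha' : a ∈ S i <;> by_cases hb' : b ∈ S i
        · rw [copyVertex_of_mem_right ha', copyVertex_of_mem_right hb']
          exact h
        · rw [copyVertex_of_mem_right ha', copyVertex_of_mem ⟨hb, hb'⟩]
          exact ⟨ha', h⟩
        · rw [copyVertex_of_mem ⟨ha, ha'⟩, copyVertex_of_mem_right hb']
          exact ⟨hb', h⟩
        · rw [copyVertex_of_mem ⟨ha, ha'⟩, copyVertex_of_mem ⟨hb, hb'⟩]
          exact ⟨rfl, h⟩

omit [Fintype ι] in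
/-- Every edge of a reflected copy has an end that is a new vertex. -/
theorem exists_inr_mem_map_copyVertex (hI : ∀ i, T.IsIndepSet (S i)) {i : ι} {e : Sym2 U}
    (he : e ∈ inducedEdges T (K i)) : ∃ y, Sum.inr ⟨i, y⟩ ∈ Sym2.map (copyVertex K S i) e := by
  induction e using Sym2.ind with
  | _ a b =>
    obtain ⟨h, ha, hb⟩ := mk_mem_inducedEdges.1 he
    by_cases ha' : a ∈ S i
    · have hb' : b ∉ S i := fun hb' => hI i ha' hb' h.ne h
      exact ⟨⟨b, hb, hb'⟩, by simp [copyVertex_of_mem (show b ∈ K i \ S i from ⟨hb, hb'⟩)]⟩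
    · exact ⟨⟨a, ha, ha'⟩, by simp [copyVertex_of_mem (show a ∈ K i \ S i from ⟨ha, ha'⟩)]⟩

omit [Fintype U] [Fintype ι] in
theorem eq_of_inr_mem_map_copyVertex {i j : ι} {e : Sym2 U} {y : ↥(K j \ S j)}
    (h : Sum.inr ⟨j, y⟩ ∈ Sym2.map (copyVertex K S i) e) : i = j := by
  obtain ⟨a, -, ha⟩ := Sym2.mem_map.1 h
  unfold copyVertex at ha
  split_ifs at ha
  simp only [Sum.inr.injEq, Sigma.mk.injEq] at ha
  exact ha.1

-- Every copied edge has a new end that determines its copy, so the edges of `T` and of the copies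
-- are pairwise disjoint. This is where independence of the `S i` is needed.
open Classical in
theorem prod_reflectionGraph_edgeFinset {M : Type*} [CommMonoid M] (hS : ∀ i, S i ⊆ K i)
    (hI : ∀ i, T.IsIndepSet (S i)) (f : Sym2 (U ⊕ (Σ i, ↥(K i \ S i))) → M) :
    ∏ e ∈ (reflectionGraph T K S).edgeFinset, f e =
      (∏ e ∈ inducedEdges T Set.univ, f (e.map Sum.inl)) *
        ∏ i, ∏ e ∈ inducedEdges T (K i), f (e.map (copyVertex K S i)) := by
  rw [reflectionGraph_edgeFinset hS, Finset.prod_union, Finset.prod_biUnion,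
    Finset.prod_image (Sym2.map.injective Sum.inl_injective).injOn]
  · congr 1
    exact Finset.prod_congr rfl fun i _ =>
      Finset.prod_image (Sym2.map.injective (copyVertex_injective i)).injOn
  · intro i _ j _ hij
    rw [Function.onFun, Finset.disjoint_left]
    rintro _ hi hj
    obtain ⟨e, he, rfl⟩ := Finset.mem_image.1 hi
    obtain ⟨e', -, h⟩ := Finset.mem_image.1 hj
    obtain ⟨y, hy⟩ := exists_inr_mem_map_copyVertex hI he
    rw [← h] at hy
    exact hij (eq_of_inr_mem_map_copyVertex hy).symm
  · rw [Finset.disjoint_left]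
    rintro _ hi hj
    obtain ⟨e, -, rfl⟩ := Finset.mem_image.1 hi
    obtain ⟨i, -, hj⟩ := Finset.mem_biUnion.1 hj
    obtain ⟨e', he', h⟩ := Finset.mem_image.1 hj
    obtain ⟨y, hy⟩ := exists_inr_mem_map_copyVertex hI he'
    rw [h] at hy
    obtain ⟨a, -, ha⟩ := Sym2.mem_map.1 hy
    cases ha

end ReflectionGraph

/-! ### Densities of reflection graphs and passage to all graphons -/

section Density

variable {Ω : Type*} [MeasurableSpace Ω] {μ : Measure Ω} [IsProbabilityMeasure μ] {W : Graphon Ω}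

omit [IsProbabilityMeasure μ] in
theorem Graphon.edgeValue_map {A B : Type*} (f : A → B) (x : B → Ω) (e : Sym2 A) :
    W.edgeValue x (e.map f) = W.edgeValue (x ∘ f) e := by
  induction e using Sym2.ind with
  | _ a b => rfl

theorem Graphon.measurable_edgeValue {V : Type*} (e : Sym2 V) :
    Measurable fun x : V → Ω => W.edgeValue x e := by
  induction e using Sym2.ind with
  | _ a b =>
    exact W.measurable_toFun.comp (f := fun x : V → Ω => (x a, x b))
      ((measurable_pi_apply a).prodMk (measurable_pi_apply b))

theorem Graphon.edgeValue_nonneg {V : Type*} (x : V → Ω) (e : Sym2 V) :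
    0 ≤ W.edgeValue x e := by
  induction e using Sym2.ind with
  | _ a b => exact W.nonneg _ _

theorem Graphon.edgeValue_le_one {V : Type*} (x : V → Ω) (e : Sym2 V) :
    W.edgeValue x e ≤ 1 := by
  induction e using Sym2.ind with
  | _ a b => exact W.le_one _ _

theorem homDensity_congr {V V' : Type*} [Fintype V] [Fintype V'] {H : SimpleGraph V}
    {H' : SimpleGraph V'} (e : H ≃g H') : homDensity μ H W = homDensity μ H' W := by
  classical
  have h := measurePreserving_comp_injective μ (f := e) e.injective
  have hm : Measurable fun x : V → Ω => ∏ e ∈ H.edgeFinset, W.edgeValue x e :=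
    Finset.measurable_prod _ fun e _ => W.measurable_edgeValue e
  unfold homDensity
  rw [← h.map_eq, integral_map h.measurable.aemeasurable (by convert hm.aestronglyMeasurable)]
  refine integral_congr_ae (.of_forall fun x => ?_)
  have : H'.edgeFinset = H.edgeFinset.image (Sym2.map e) := by
    ext q
    induction q using Sym2.ind with
    | _ a b =>
      simp only [SimpleGraph.mem_edgeFinset, Finset.mem_image]
      constructor
      · intro hab
        refine ⟨s(e.symm a, e.symm b), e.symm.map_rel_iff.2 hab, by simp⟩
      · rintro ⟨q, hq, h⟩
        rw [← h]
        induction q using Sym2.ind with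
        | _ c d => exact e.map_rel_iff.2 hq
  simp only [← Graphon.edgeValue_map]
  convert (Finset.prod_image (s := H.edgeFinset) (f := W.edgeValue x)
    (Sym2.map.injective e.injective).injOn).symm using 2

theorem homDensity_pathGraph_two : homDensity μ (SimpleGraph.pathGraph 2) W = W.density μ := by
  classical
  have hE : (SimpleGraph.pathGraph 2).edgeFinset = {s(0, 1)} := by
    ext e
    induction e using Sym2.ind with
    | _ a b =>
      simp only [SimpleGraph.mem_edgeFinset, SimpleGraph.mem_edgeSet,
        SimpleGraph.pathGraph_two_eq_top, SimpleGraph.top_adj, Finset.mem_singleton, Sym2.eq_iff]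
      fin_cases a <;> fin_cases b <;> simp
  have h := (measurePreserving_finTwoArrow μ).integral_comp' (Function.uncurry W.toFun)
  have hi : Integrable (Function.uncurry W.toFun) (μ.prod μ) :=
    .of_bound W.measurable_toFun.aestronglyMeasurable 1 (.of_forall fun q => by
      exact (Real.norm_of_nonneg (W.nonneg q.1 q.2)).trans_le (W.le_one _ _))
  rw [integral_prod _ hi] at h
  refine Eq.trans ?_ h
  unfold homDensity
  refine integral_congr_ae (.of_forall fun x => ?_)
  exact (Finset.prod_congr (by convert hE) fun _ _ => rfl).trans
    (Finset.prod_singleton (fun e => W.edgeValue x e) s(0, 1))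

/-- Independent points on the vertices of a tree and on each of finitely many copies of it give
independent points on the vertices of the reflection graph. -/
theorem measurePreserving_sumElim_sigma {U ι : Type*} [Fintype U] [Fintype ι]
    (C : ι → Set U) [Fintype (U ⊕ (Σ i, ↥(C i)))] :
    MeasurePreserving
      (fun q : (U → Ω) × (ι → U → Ω) =>
        (Sum.elim q.1 fun a => q.2 a.1 a.2 : U ⊕ (Σ i, ↥(C i)) → Ω))
      ((Measure.pi fun _ => μ).prod (Measure.pi fun _ => Measure.pi fun _ => μ))
      (Measure.pi fun _ => μ) := by
  classical
  have hm : Measurable (fun q : (U → Ω) × (ι → U → Ω) =>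
      (Sum.elim q.1 fun a => q.2 a.1 a.2 : U ⊕ (Σ i, ↥(C i)) → Ω)) := by
    refine measurable_pi_iff.2 ?_
    rintro (v | ⟨i, v⟩) <;> simp only [Sum.elim_inl, Sum.elim_inr] <;> fun_prop
  refine ⟨hm, (Measure.pi_eq fun s hs => ?_).symm⟩
  rw [Measure.map_apply hm (MeasurableSet.univ_pi hs)]
  have : (fun q : (U → Ω) × (ι → U → Ω) =>
      (Sum.elim q.1 fun a => q.2 a.1 a.2 : U ⊕ (Σ i, ↥(C i)) → Ω)) ⁻¹' Set.univ.pi s =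
      (Set.univ.pi fun v => s (.inl v)) ×ˢ
      -- Each copy carries points for all of `U`; those outside `C i` are unconstrained, the
      -- intersection over an empty index being everything.
      (Set.univ.pi fun i => Set.univ.pi fun v => ⋂ h : v ∈ C i, s (.inr ⟨i, v, h⟩)) := by
    ext ⟨x, z⟩
    simp [Set.mem_pi, Sigma.forall]
  rw [this, Measure.prod_prod, Measure.pi_pi, Measure.pi_pi]
  have h1 : ∏ a, μ (s a) = (∏ v, μ (s (.inl v))) * ∏ i, ∏ v : C i, μ (s (.inr ⟨i, v⟩)) := by
    rw [← Fintype.prod_sigma', ← Fintype.prod_sum_type fun a => μ (s a)]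
    congr!
  rw [h1]
  congr 1
  refine Finset.prod_congr rfl fun i _ => ?_
  rw [Measure.pi_pi, ← Finset.prod_subset (Finset.subset_univ (C i).toFinset)]
  · rw [← Finset.prod_coe_sort]
    refine Fintype.prod_equiv (Equiv.subtypeEquivRight fun v => Set.mem_toFinset) _ _ fun v => ?_
    have hv : (v : U) ∈ C i := Set.mem_toFinset.1 v.2
    simp only [hv, Set.iInter_true]
    rfl
  · intro v _ hv
    rw [Set.mem_toFinset] at hv
    simp [hv]

/-- Given the points of `T`, the copies use disjoint sets of new independent points, so Fubini
splits the inner integral into a product. -/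
theorem homDensity_reflectionGraph {U ι : Type*} [Fintype U] [Fintype ι] {T : SimpleGraph U}
    {K S : ι → Set U} [Fintype (U ⊕ (Σ i, ↥(K i \ S i)))]
    {ε : ℝ} (hε : 0 < ε) (hW : ∀ a b, ε ≤ W.toFun a b)
    (hS : ∀ i, S i ⊆ K i) (hI : ∀ i, T.IsIndepSet (S i)) :
    homDensity μ (reflectionGraph T K S) W =
      ∫ x, W.edgeProd (inducedEdges T Set.univ) x *
        ∏ i, W.rooted μ T (K i) (K i \ S i) x ∂(Measure.pi fun _ => μ) := by
  classical
  have h := measurePreserving_sumElim_sigma (μ := μ) fun i => K i \ S i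
  have hprod : ∀ x : U ⊕ (Σ i, ↥(K i \ S i)) → Ω,
      ∏ e ∈ (reflectionGraph T K S).edgeFinset, W.edgeValue x e =
      W.edgeProd (inducedEdges T Set.univ) (x ∘ Sum.inl) *
        ∏ i, W.edgeProd (inducedEdges T (K i)) (x ∘ copyVertex K S i) := by
    intro x
    convert prod_reflectionGraph_edgeFinset hS hI (W.edgeValue x) using 2
    · congr!
    · simp only [Graphon.edgeProd, Graphon.edgeValue_map]
    · simp only [Graphon.edgeProd, Graphon.edgeValue_map]
  have hm : Measurable fun x : U ⊕ (Σ i, ↥(K i \ S i)) → Ω =>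
      ∏ e ∈ (reflectionGraph T K S).edgeFinset, W.edgeValue x e :=
    Finset.measurable_prod _ fun e _ => W.measurable_edgeValue e
  have hcopy : ∀ (x : U → Ω) (z : ι → U → Ω) (i : ι),
      (Sum.elim x fun a => z a.1 a.2 : U ⊕ (Σ i, ↥(K i \ S i)) → Ω) ∘ copyVertex K S i =
        glue (K i \ S i) x (z i) := by
    intro x z i
    funext v
    by_cases hv : v ∈ K i \ S i
    · simp only [Function.comp_apply, copyVertex, dif_pos hv, glue, if_pos hv, Sum.elim_inr]
    · simp only [Function.comp_apply, copyVertex, dif_neg hv, glue, if_neg hv, Sum.elim_inl]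
  have hb : BddMeas fun q : (U → Ω) × (ι → U → Ω) => W.edgeProd (inducedEdges T Set.univ) q.1 *
      ∏ i, W.edgeProd (inducedEdges T (K i)) (glue (K i \ S i) q.1 (q.2 i)) :=
    ((Graphon.bddPos_edgeProd hε hW _).bddMeas.comp measurable_fst).mul
      (BddMeas.prod _ fun i _ => (Graphon.bddPos_edgeProd hε hW _).bddMeas.comp
        ((measurable_glue _).comp (measurable_fst.prodMk
          ((measurable_pi_apply i).comp measurable_snd))))
  unfold homDensity
  rw [← h.map_eq, integral_map h.measurable.aemeasurable (by convert hm.aestronglyMeasurable)]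
  have : ∀ q : (U → Ω) × (ι → U → Ω), (∏ e ∈ (reflectionGraph T K S).edgeFinset,
      W.edgeValue (Sum.elim q.1 fun a => q.2 a.1 a.2) e) =
      W.edgeProd (inducedEdges T Set.univ) q.1 *
      ∏ i, W.edgeProd (inducedEdges T (K i)) (glue (K i \ S i) q.1 (q.2 i)) := by
    intro q
    rw [hprod]
    simp only [hcopy, Sum.elim_comp_inl]
  refine Eq.trans (integral_congr_ae (.of_forall fun q => ?_)) (Eq.trans
    (integral_prod _ (hb.integrable _)) (integral_congr_ae (.of_forall fun x => ?_)))
  · convert this q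
  · dsimp only
    rw [integral_const_mul]
    congr 1
    exact integral_fintype_prod_eq_prod (μ := fun _ : ι => Measure.pi fun _ : U => μ)
      fun i z => W.edgeProd (inducedEdges T (K i)) (glue (K i \ S i) x z)

theorem density_pow_le_homDensity_reflectionGraph {U ι : Type*} [Fintype U] [Fintype ι]
    {T : SimpleGraph U} {K S : ι → Set U} [Fintype (U ⊕ (Σ i, ↥(K i \ S i)))]
    {ε : ℝ} (hε : 0 < ε) (hW : ∀ a b, ε ≤ W.toFun a b) (hT : T.IsTree)
    (hK : ∀ i, (T.induce (K i)).IsTree) (hS : ∀ i, S i ⊆ K i) (hI : ∀ i, T.IsIndepSet (S i)) :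
    W.density μ ^ (reflectionGraph T K S).edgeSet.ncard ≤
      homDensity μ (reflectionGraph T K S) W := by
  classical
  rw [homDensity_reflectionGraph hε hW hS hI]
  refine le_of_eq_of_le ?_ (Graphon.pow_density_le_integral hε hW hT hK)
  -- The product formula for a constant function counts the edges.
  have := prod_reflectionGraph_edgeFinset (T := T) hS hI fun _ => W.density μ
  simp only [Finset.prod_const] at this
  rw [pow_add, ← Finset.prod_pow_eq_pow_sum, ← this, ← SimpleGraph.coe_edgeFinset,
    Set.ncard_coe_finset]
  congr!

/-- The convex combination of the constant graphon `1` and of a graphon `W`. -/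
noncomputable def Graphon.mix (W : Graphon Ω) (t : ℝ) (h0 : 0 ≤ t) (h1 : t ≤ 1) : Graphon Ω where
  toFun a b := t + (1 - t) * W.toFun a b
  measurable_toFun := (W.measurable_toFun.const_mul (1 - t)).const_add t
  symm_toFun a b := by rw [W.symm_toFun]
  nonneg a b := add_nonneg h0 (mul_nonneg (sub_nonneg.2 h1) (W.nonneg a b))
  le_one a b := by nlinarith [W.le_one a b]

/-- For `t > 0` the mixture is at least `t`, so this limit removes the positivity assumption on `W`.
-/
theorem tendsto_homDensity_mix {V : Type*} [Fintype V] (H : SimpleGraph V) {t : ℕ → ℝ}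
    (h0 : ∀ n, 0 ≤ t n) (h1 : ∀ n, t n ≤ 1) (ht : Filter.Tendsto t Filter.atTop (nhds 0)) :
    Filter.Tendsto (fun n => homDensity μ H (W.mix (t n) (h0 n) (h1 n))) Filter.atTop
      (nhds (homDensity μ H W)) := by
  refine tendsto_integral_of_dominated_convergence (fun _ => 1) (fun n => ?_)
    (integrable_const 1) (fun n => .of_forall fun x => ?_) (.of_forall fun x => ?_)
  · exact (Finset.measurable_prod _ fun e _ =>
      Graphon.measurable_edgeValue e).aestronglyMeasurable
  · rw [Real.norm_of_nonneg (Finset.prod_nonneg fun e _ => Graphon.edgeValue_nonneg _ _)]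
    exact Finset.prod_le_one (fun e _ => Graphon.edgeValue_nonneg _ _)
      fun e _ => Graphon.edgeValue_le_one _ _
  · refine tendsto_finsetProd _ fun e _ => ?_
    induction e using Sym2.ind with
    | _ a b =>
      change Filter.Tendsto (fun n => t n + (1 - t n) * W.toFun (x a) (x b)) _
        (nhds (W.toFun (x a) (x b)))
      simpa using ht.add ((ht.const_sub 1).mul_const (W.toFun (x a) (x b)))

end Density

theorem IsReflectionTree.isSidorenko {V : Type u} [Fintype V] {H : SimpleGraph V}
    (h : IsReflectionTree H) : IsSidorenko.{u, v} H := by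
  classical
  obtain ⟨n, r, T, K, S, hT, hKS, ⟨e⟩⟩ := h
  refine ⟨(reflectionGraph_colorable hT.isBipartite).of_hom e.toHom, ?_⟩
  intro Ω _ μ _ W
  have h0 : ∀ n : ℕ, (0 : ℝ) < 1 / (n + 1) := fun n => Nat.one_div_pos_of_nat
  have h1 : ∀ n : ℕ, (1 : ℝ) / (n + 1) ≤ 1 := fun n => by
    rw [div_le_one (by positivity)]
    linarith [Nat.cast_nonneg (α := ℝ) n]
  have ht := tendsto_one_div_add_atTop_nhds_zero_nat (𝕜 := ℝ)
  refine le_of_tendsto_of_tendsto' ((tendsto_homDensity_mix (W := W) (μ := μ)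
    (SimpleGraph.pathGraph 2) (fun n => (h0 n).le) h1 ht).pow _)
    (tendsto_homDensity_mix H (fun n => (h0 n).le) h1 ht) fun n => ?_
  have hcard : H.edgeSet.ncard = (reflectionGraph T K S).edgeSet.ncard := by
    rw [← Nat.card_coe_set_eq, ← Nat.card_coe_set_eq]
    exact Nat.card_congr e.mapEdgeSet
  rw [homDensity_pathGraph_two, homDensity_congr e, hcard]
  refine density_pow_le_homDensity_reflectionGraph (h0 n) (fun a b => ?_) hT
    (fun i => (hKS i).1) (fun i => (hKS i).2.1) fun i => (hKS i).2.2
  exact le_add_of_nonneg_right (mul_nonneg (sub_nonneg.2 (h1 n)) (W.nonneg a b))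

/-! ### Even cycles and Conlon–Fox–Sudakov graphs -/

section Examples

theorem SimpleGraph.isAcyclic_pathGraph (n : ℕ) : (SimpleGraph.pathGraph n).IsAcyclic := by
  rw [SimpleGraph.isAcyclic_iff_forall_adj_isBridge]
  intro u v huv
  wlog h : u.val + 1 = v.val generalizing u v
  · rw [Sym2.eq_swap]
    exact this huv.symm ((SimpleGraph.pathGraph_adj.1 huv).resolve_left h)
  rw [SimpleGraph.isBridge_iff]
  rintro ⟨p⟩
  -- Any walk from `u` to `v = u + 1` must leave the initial segment up to `u`, which is possible
  -- only along the deleted edge.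
  obtain ⟨⟨⟨a, b⟩, hab⟩, -, ha, hb⟩ := p.exists_boundary_dart {a | a ≤ u} (by simp)
    (by simp only [Set.mem_ofPred_eq, Fin.le_def]; omega)
  simp only [Set.mem_ofPred_eq, Fin.le_def, not_le] at ha hb hab
  rw [SimpleGraph.deleteEdges_adj, SimpleGraph.pathGraph_adj] at hab
  have h1 : a = u := Fin.ext (by omega)
  have h2 : b = v := Fin.ext (by omega)
  exact hab.2 (by rw [h1, h2]; rfl)

theorem SimpleGraph.isTree_pathGraph (n : ℕ) : (SimpleGraph.pathGraph (n + 1)).IsTree :=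
  ⟨SimpleGraph.pathGraph_connected n, SimpleGraph.isAcyclic_pathGraph _⟩

theorem SimpleGraph.cycleGraph_adj_iff_val {n : ℕ} (hn : 2 ≤ n) {u v : Fin n} :
    (SimpleGraph.cycleGraph n).Adj u v ↔ u.val = v.val + 1 ∨ v.val = u.val + 1 ∨
      (u.val = 0 ∧ v.val = n - 1) ∨ (v.val = 0 ∧ u.val = n - 1) := by
  rw [SimpleGraph.cycleGraph_adj']
  rcases lt_trichotomy u v with h | rfl | h
  · have h1 := Fin.coe_sub_iff_lt.2 h
    have h2 := Fin.coe_sub_iff_le.2 h.le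
    rw [Fin.lt_def] at h
    omega
  · have h1 := Fin.coe_sub_iff_le.2 (le_refl u)
    omega
  · have h1 := Fin.coe_sub_iff_lt.2 h
    have h2 := Fin.coe_sub_iff_le.2 h.le
    rw [Fin.lt_def] at h
    omega

/-- Reflect the path with `k` edges along its two ends, which are not adjacent because `k ≥ 2`. -/
theorem isReflectionTree_cycleGraph {k : ℕ} (hk : 2 ≤ k) :
    IsReflectionTree (SimpleGraph.cycleGraph (2 * k)) := by
  let S : Fin 1 → Set (Fin (k + 1)) := fun _ => {y | y.val = 0 ∨ y.val = k}
  have hS : ∀ (i : Fin 1) {y : Fin (k + 1)}, y ∈ S i ↔ y.val = 0 ∨ y.val = k :=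
    fun _ _ => Iff.rfl
  have hC : ∀ (i : Fin 1) (y : ↥((Set.univ : Set (Fin (k + 1))) \ S i)),
      1 ≤ y.1.val ∧ y.1.val ≤ k - 1 := by
    intro i y
    have := y.2.2
    rw [hS i] at this
    omega
  refine ⟨k + 1, 1, SimpleGraph.pathGraph (k + 1), fun _ => Set.univ, S,
    SimpleGraph.isTree_pathGraph k, fun i => ⟨?_, Set.subset_univ _, ?_⟩, ⟨?_⟩⟩
  · exact (SimpleGraph.induceUnivIso _).isTree_iff.2 (SimpleGraph.isTree_pathGraph k)
  · intro a ha b hb _ hab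
    rw [hS i] at ha hb
    rw [SimpleGraph.pathGraph_adj] at hab
    omega
  -- The path runs along `0, …, k`, and the copy of an inner vertex `y` returns on the other side,
  -- at `2k - y`.
  let g : Fin (k + 1) ⊕ (Σ i : Fin 1, ↥((Set.univ : Set (Fin (k + 1))) \ S i)) → Fin (2 * k) :=
    Sum.elim (fun a => ⟨a.val, by omega⟩)
      fun q => ⟨2 * k - q.2.1.val, by have := hC q.1 q.2; omega⟩
  have hg1 : ∀ a, (g (.inl a)).val = a.val := fun _ => rfl
  have hg2 : ∀ i y, (g (.inr ⟨i, y⟩)).val = 2 * k - y.1.val := fun _ _ => rfl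
  have hbij : Function.Bijective g := by
    constructor
    · rintro (a | ⟨i, a⟩) (b | ⟨j, b⟩) h <;> have h := congrArg Fin.val h
      · rw [hg1, hg1] at h
        rw [Fin.ext h]
      · have := hC j b
        rw [hg1, hg2] at h
        omega
      · have := hC i a
        rw [hg1, hg2] at h
        omega
      · have h1 := hC i a
        have h2 := hC j b
        rw [hg2, hg2] at h
        obtain rfl := Subsingleton.elim i j
        obtain rfl : a = b := Subtype.ext (Fin.ext (by omega))
        rfl
    · intro c
      by_cases hc : c.val ≤ k
      · exact ⟨.inl ⟨c.val, by omega⟩, rfl⟩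
      · refine ⟨.inr ⟨0, ⟨⟨2 * k - c.val, by omega⟩, trivial, ?_⟩⟩, Fin.ext ?_⟩
        · rw [hS 0]
          simp only
          omega
        · rw [hg2]
          simp only
          omega
  refine SimpleGraph.Iso.symm ⟨Equiv.ofBijective g hbij, ?_⟩
  rintro (a | ⟨i, a⟩) (b | ⟨j, b⟩) <;>
    rw [Equiv.ofBijective_apply, Equiv.ofBijective_apply,
      SimpleGraph.cycleGraph_adj_iff_val (by omega)]
  · change _ ↔ (SimpleGraph.pathGraph (k + 1)).Adj a b
    rw [SimpleGraph.pathGraph_adj, hg1, hg1]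
    omega
  · change _ ↔ a ∈ S j ∧ (SimpleGraph.pathGraph (k + 1)).Adj a b
    have := hC j b
    rw [SimpleGraph.pathGraph_adj, hg1, hg2, hS j]
    omega
  · change _ ↔ b ∈ S i ∧ (SimpleGraph.pathGraph (k + 1)).Adj a b
    have := hC i a
    rw [SimpleGraph.pathGraph_adj, hg1, hg2, hS i]
    omega
  · change _ ↔ i = j ∧ (SimpleGraph.pathGraph (k + 1)).Adj a b
    have h1 := hC i a
    have h2 := hC j b
    have h3 := Subsingleton.elim i j
    rw [SimpleGraph.pathGraph_adj, hg2, hg2]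
    omega

theorem SimpleGraph.isTree_of_center {V : Type*} {G : SimpleGraph V} (c : V)
    (h1 : ∀ v, v ≠ c → G.Adj c v) (h2 : ∀ u v, G.Adj u v → u = c ∨ v = c) : G.IsTree := by
  have : G = SimpleGraph.starGraph c := by
    ext u v
    rw [SimpleGraph.starGraph_adj]
    refine ⟨fun h => ⟨h.ne, h2 u v h⟩, ?_⟩
    rintro ⟨h, rfl | rfl⟩
    · exact h1 v h.symm
    · exact (h1 u h).symm
  rw [this]
  exact SimpleGraph.isTree_starGraph c

/-- The tree is the star with centre `x` and leaves `B`. A vertex `b ≠ x` of `A` is a second copy of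
the centre: reflect the substar on `x` and the neighbours of `b` along those neighbours. -/
theorem HasVertexCompleteToOtherSide.isReflectionTree {V : Type*} [Finite V] {H : SimpleGraph V}
    (h : HasVertexCompleteToOtherSide H) : IsReflectionTree H := by
  obtain ⟨A, B, x, hAB, hU, hx, hxB⟩ := h
  have hdisj : ∀ {v}, v ∈ A → v ∈ B → False := fun ha hb => Set.disjoint_left.1 hAB.disjoint ha hb
  have hcov : ∀ v, v ∈ A ∨ v ∈ B := fun v => (Set.mem_union _ _ _).1 (hU ▸ Set.mem_univ v)
  have hadjA : ∀ {a b}, a ∈ A → H.Adj a b → b ∈ B := fun ha h => hAB.mem_of_mem_adj ha h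
  have hadjB : ∀ {a b}, a ∈ B → H.Adj a b → b ∈ A := fun ha h => hAB.symm.mem_of_mem_adj ha h
  obtain ⟨n, ⟨α⟩⟩ := Finite.exists_equiv_fin {v // v ∈ B ∨ v = x}
  obtain ⟨r, ⟨β⟩⟩ := Finite.exists_equiv_fin {v // v ∈ A ∧ v ≠ x}
  let a : Fin n → V := fun i => α.symm i
  let b : Fin r → V := fun i => β.symm i
  have ha : Function.Injective a := Subtype.val_injective.comp α.symm.injective
  have hb : Function.Injective b := Subtype.val_injective.comp β.symm.injective
  have ha' : ∀ i, a i ∈ B ∨ a i = x := fun i => (α.symm i).2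
  have hb' : ∀ i, b i ∈ A ∧ b i ≠ x := fun i => (β.symm i).2
  have hasurj : ∀ v, v ∈ B ∨ v = x → ∃ i, a i = v := fun v hv => ⟨α ⟨v, hv⟩, by simp [a]⟩
  have hbsurj : ∀ v, v ∈ A → v ≠ x → ∃ i, b i = v := fun v hv hv' =>
    ⟨β ⟨v, hv, hv'⟩, by simp [b]⟩
  obtain ⟨c, hc⟩ := hasurj x (.inr rfl)
  let T : SimpleGraph (Fin n) := H.comap a
  have hT1 : ∀ v, v ≠ c → T.Adj c v := by
    intro v hv
    change H.Adj (a c) (a v)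
    rw [hc]
    exact hxB _ ((ha' v).resolve_right fun h => hv (ha (h.trans hc.symm)))
  have hT2 : ∀ u v, T.Adj u v → u = c ∨ v = c := by
    intro u v huv
    rcases ha' u with hu | hu
    · have hv := hadjB hu huv
      exact .inr (ha (((ha' v).resolve_left fun h => hdisj hv h).trans hc.symm))
    · exact .inl (ha (hu.trans hc.symm))
  let S : Fin r → Set (Fin n) := fun i => {v | H.Adj (b i) (a v)}
  let K : Fin r → Set (Fin n) := fun i => insert c (S i)
  have hcS : ∀ i, c ∉ S i := fun i hi => by
    change H.Adj (b i) (a c) at hi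
    exact hdisj hx (hc ▸ hadjA (hb' i).1 hi)
  have hC : ∀ (i) (y : ↥(K i \ S i)), y.1 = c := fun i y => y.2.1.resolve_right y.2.2
  refine ⟨n, r, T, K, S, SimpleGraph.isTree_of_center c hT1 hT2, fun i => ⟨?_, ?_, ?_⟩, ⟨?_⟩⟩
  · refine SimpleGraph.isTree_of_center ⟨c, .inl rfl⟩ (fun v hv => ?_) fun u v huv => ?_
    · exact hT1 v fun h => hv (Subtype.ext h)
    · exact (hT2 u v huv).imp Subtype.ext Subtype.ext
  · exact Set.subset_insert _ _
  · intro u hu v hv _ huv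
    rcases hT2 u v huv with rfl | rfl
    · exact hcS i hu
    · exact hcS i hv
  let g : Fin n ⊕ (Σ i, ↥(K i \ S i)) → V := Sum.elim a fun q => b q.1
  have hne : ∀ i j, a i ≠ b j := by
    intro i j h
    rcases ha' i with hi | hi
    · exact hdisj (hb' j).1 (h ▸ hi)
    · exact (hb' j).2 (h.symm.trans hi)
  have hbij : Function.Bijective g := by
    constructor
    · rintro (u | ⟨i, u⟩) (v | ⟨j, v⟩) h
      · rw [ha h]
      · exact (hne _ _ h).elim
      · exact (hne _ _ h.symm).elim
      · obtain rfl := hb h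
        obtain rfl : u = v := Subtype.ext ((hC i u).trans (hC i v).symm)
        rfl
    · intro v
      by_cases hv : v ∈ B ∨ v = x
      · obtain ⟨i, hi⟩ := hasurj v hv
        exact ⟨.inl i, hi⟩
      · rw [not_or] at hv
        obtain ⟨i, hi⟩ := hbsurj v ((hcov v).resolve_right hv.1) hv.2
        exact ⟨.inr ⟨i, ⟨c, .inl rfl, hcS i⟩⟩, hi⟩
  have hcopy : ∀ (i) (y : ↥(K i \ S i)) (u : Fin n), H.Adj (b i) (a u) ↔ u ∈ S i ∧ T.Adj y u := by
    intro i y u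
    refine ⟨fun h => ⟨h, ?_⟩, fun h => h.1⟩
    rw [hC i y]
    exact hT1 u fun h' => hcS i (h' ▸ h)
  refine SimpleGraph.Iso.symm ⟨Equiv.ofBijective g hbij, ?_⟩
  rintro (u | ⟨i, u⟩) (v | ⟨j, v⟩) <;> rw [Equiv.ofBijective_apply, Equiv.ofBijective_apply]
  · exact Iff.rfl
  · change H.Adj (a u) (b j) ↔ u ∈ S j ∧ T.Adj u v
    rw [H.adj_comm, hcopy j v, T.adj_comm]
  · exact hcopy i u v
  · change H.Adj (b i) (b j) ↔ i = j ∧ T.Adj u v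
    rw [hC i u, hC j v]
    exact iff_of_false (fun h => hdisj (hb' j).1 (hadjA (hb' i).1 h)) fun h => h.2.ne rfl

end Examples

theorem mainTheorem1 :
    (∀ (V : Type u) [Fintype V] (H : SimpleGraph V), IsReflectionTree H → IsSidorenko.{u, v} H) ∧
    (∀ k : ℕ, 2 ≤ k → IsReflectionTree (SimpleGraph.cycleGraph (2 * k))) ∧
    (∀ (V : Type u) [Fintype V] (H : SimpleGraph V),
      HasVertexCompleteToOtherSide H → IsReflectionTree H) :=
  ⟨fun _ _ _ h => h.isSidorenko, fun _ hk => isReflectionTree_cycleGraph hk,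
    fun _ _ _ h => h.isReflectionTree⟩
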